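/- Let $\mathcal H$ be a reproducing kernel Hilbert space of complex-valued functions on a set $X$ with reproducing kernel $k$. Let $\mathrm{Mult}(\mathcal H)=\{\varphi:X\to\mathbb C:\ \varphi f\in\mathcal H \text{ for all } f\in\mathcal H\}$ be its multiplier algebra, with norm $\|\varphi\|=\|M_\varphi\|$, where $M_\varphi f=\varphi f$ (a bounded operator on $\mathcal H$ by the closed graph theorem), and with the weak-$*$ topology that it inherits, via $\varphi\mapsto M_\varphi$, from $B(\mathcal H)$ as the dual space of the trace class operators. Suppose that $\mathcal H$ is a complete Pick space, i.e. for all $r,n\in\mathbb N$, $z_1,\dots,z_n\in X$ and $W_1,\dots,W_n\in M_r(\mathbb C)$, if the block matrix $\big[k(z_i,z_j)(I-W_iW_j^*)\big]_{i,j=1}^n$ is positive semidefinite, then there is $\Phi\in M_r(\mathrm{Mult}(\mathcal H))$ of norm at most $1$ (as an operator on $\mathcal H\otimes\mathbb C^r$) with $\Phi(z_i)=W_i$ for $i=1,\dots,n$. Suppose also that $k$ is normalized at $x_0\in X$, i.e. $k(x,x_0)=1$ for all $x\in X$ (so that $1\in\mathcal H$ and $\mathrm{Mult}(\mathcal H)\subset\mathcal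 H$). A bounded linear functional $\tau\neq0$ on $\mathcal H$ is called partially multiplicative if $\tau(fg)=\tau(f)\tau(g)$ whenever $f,g\in\mathcal H$ and $fg\in\mathcal H$. The set $X$ is a maximal domain for $\mathcal H$ if every bounded partially multiplicative functional on $\mathcal H$ is of the form $f\mapsto f(x)$ for some $x\in X$. A character on $\mathrm{Mult}(\mathcal H)$ is a nonzero multiplicative linear functional; for $x \in X$, let $\delta_x$ denote the character $\varphi\mapsto\varphi(x)$. The Gleason part of a character $\rho$ is the set of all characters $\sigma$ with $\|\sigma-\rho\|<2$, the norm being that of functionals on $\mathrm{Mult}(\mathcal H)$. For every character $\rho$ on $\mathrm{Mult}(\mathcal H)$, the following are equivalent: (i) $\rho$ extends to a bounded partially multiplicative functional on $\mathcal H$; (ii) $\rho$ is weak-$*$ continuous; (iii) $\rho$ belongs to the Gleason part of $\delta_{x_0}$. Moreover, the following are equivalent: (i') $X$ is a maximal domain for $\mathcal H$; (ii') every weak-$*$ continuous character on $\mathrm{Mult}(\mathcal H)$ is equal to $\delta_x$ for some $x\in X$; (iii') the set $\{\delta_x : x\in X\}$ is a Gleason part, i.e. it is the Gleason part of some character on $\mathrm{Mult}(\mathcal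 H)$. -/

import Mathlib

open scoped ComplexOrder ENNReal

noncomputable section

namespace PickSpace

section Defs

variable {X : Type*} (H : Type*) [NormedAddCommGroup H] [InnerProductSpace ℂ H]
  [RKHS ℂ H X ℂ]

/-- The multiplier algebra `Mult(H)`: all functions `φ : X → ℂ` such that `φ f ∈ H` for every
`f ∈ H`. -/
def Mult : Subalgebra ℂ (X → ℂ) where
  carrier := {φ | ∀ f : H, ∃ g : H, ∀ x, g x = φ x * f x}
  mul_mem' := by
    intro φ ψ hφ hψ f
    obtain ⟨g, hg⟩ := hψ f
    obtain ⟨h, hh⟩ := hφ g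
    exact ⟨h, fun x => by rw [hh, hg, Pi.mul_apply, mul_assoc]⟩
  add_mem' := by
    intro φ ψ hφ hψ f
    obtain ⟨g, hg⟩ := hφ f
    obtain ⟨h, hh⟩ := hψ f
    exact ⟨g + h, fun x => by
      rw [RKHS.coe_add, Pi.add_apply, Pi.add_apply, hg, hh, add_mul]⟩
  algebraMap_mem' := by
    intro c f
    exact ⟨c • f, fun x => by simp⟩

variable {H}

/-- The function `φ f`, as an element of `H`. -/
def mulFun (φ : Mult H) (f : H) : H := (φ.2 f).choose

theorem mulFun_apply (φ : Mult H) (f : H) (x : X) :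
    mulFun φ f x = (φ : X → ℂ) x * f x := (φ.2 f).choose_spec x

/-- Multiplication by `φ`, as a linear map. -/
def mulLin (φ : Mult H) : H →ₗ[ℂ] H where
  toFun := mulFun φ
  map_add' f g := by
    ext x
    simp [mulFun_apply, mul_add]
  map_smul' c f := by
    ext x
    simp [mulFun_apply]
    ring

variable [CompleteSpace H]

/-- The multiplication operator `M_φ : H → H`, `f ↦ φ f`, which is bounded by the closed graph
theorem. -/
def mulOp (φ : Mult H) : H →L[ℂ] H :=
  ContinuousLinearMap.ofSeqClosedGraph (g := mulLin φ) (by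
    intro u f g hu hgu
    ext x
    have h1 := ((RKHS.continuous_eval (H := H) x).tendsto g).comp hgu
    have h2 := (((RKHS.continuous_eval (H := H) x).tendsto f).comp hu).const_mul ((φ : X → ℂ) x)
    refine tendsto_nhds_unique h1 ?_
    have h3 : mulLin φ f x = (φ : X → ℂ) x * f x := mulFun_apply φ f x
    rw [h3]
    exact h2.congr fun n => (mulFun_apply φ (u n) x).symm)

theorem mulOp_apply (φ : Mult H) (f : H) (x : X) :
    mulOp φ f x = (φ : X → ℂ) x * f x := mulFun_apply φ f x

variable (H)

/-- The scalar reproducing kernel `k(z, w) = ⟨k_w, k_z⟩`, where `f(w) = ⟨f, k_w⟩`. -/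
def ker (z w : X) : ℂ := RKHS.kernel H z w 1

/-- The kernel is normalized at `x₀`: `k(x, x₀) = 1` for all `x`. -/
def IsNormalizedAt (x₀ : X) : Prop := ∀ x : X, ker H x x₀ = 1

variable {H}

/-- A matrix `Φ` of multipliers has norm at most `1`, i.e. it acts (by matrix multiplication) as a
contraction on the Hilbert space direct sum of `r` copies of `H`. -/
def IsContractive {r : ℕ} (Φ : Matrix (Fin r) (Fin r) (Mult H)) : Prop :=
  ∀ f : Fin r → H, ∑ a, ‖∑ b, mulOp (Φ a b) (f b)‖ ^ 2 ≤ ∑ b, ‖f b‖ ^ 2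

variable (H)

/-- Complete Pick spaces: for all `r`, all points `z₁, …, zₙ` and all complex `r × r` matrices
`W₁, …, Wₙ`, if the `nr × nr` block matrix `[k(zᵢ, zⱼ) (I - Wᵢ Wⱼ^*)]` is positive semidefinite,
then some `Φ ∈ M_r(Mult(H))` of norm at most `1` satisfies `Φ(zᵢ) = Wᵢ` for all `i`. -/
def IsCompletePick : Prop :=
  ∀ (r n : ℕ) (z : Fin n → X) (W : Fin n → Matrix (Fin r) (Fin r) ℂ),
    (Matrix.of fun p q : Fin n × Fin r =>
      ker H (z p.1) (z q.1) * (1 - W p.1 * (W q.1).conjTranspose) p.2 q.2).PosSemidef →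
    ∃ Φ : Matrix (Fin r) (Fin r) (Mult H), IsContractive Φ ∧
      ∀ i a b, (Φ a b : X → ℂ) (z i) = W i a b

/-- Characters of `Mult(H)`, i.e. the points of its maximal ideal space: multiplicative linear
functionals with `ρ(1) = 1` (equivalently, nonzero multiplicative linear functionals). -/
abbrev Character : Type _ := Mult H →ₐ[ℂ] ℂ

/-- The character `δ_x` of evaluation at `x`. -/
def evalChar (x : X) : Character H := (Pi.evalAlgHom ℂ (fun _ : X => ℂ) x).comp (Mult H).val

variable {H}

/-- The norm `‖ρ₁ - ρ₂‖` of a difference of characters as a functional on `Mult(H)`, the latter with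
the norm `‖φ‖ = ‖M_φ‖`. -/
def charDist (ρ₁ ρ₂ : Character H) : ℝ≥0∞ :=
  ⨆ (φ : Mult H) (_ : ‖mulOp φ‖ ≤ 1), ‖ρ₁ φ - ρ₂ φ‖ₑ

/-- The Gleason part of `ρ`: all characters `σ` with `‖σ - ρ‖ < 2`. -/
def gleasonPart (ρ : Character H) : Set (Character H) := {σ | charDist σ ρ < 2}

/-- A set of characters is a Gleason part if it is the Gleason part of some character. -/
def IsGleasonPart (S : Set (Character H)) : Prop := ∃ ρ : Character H, S = gleasonPart ρ

variable (H)

/-- The weak-* topology on `B(H)` as the dual of the trace class operators (the σ-weak topology):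
the coarsest topology such that the functionals `T ↦ ∑ₙ ⟨T fₙ, gₙ⟩`, with `(fₙ)` and `(gₙ)` square
summable sequences in `H`, are continuous. -/
abbrev sigmaWeak : TopologicalSpace (H →L[ℂ] H) :=
  ⨅ (f : lp (fun _ : ℕ => H) 2) (g : lp (fun _ : ℕ => H) 2),
    TopologicalSpace.induced (fun T => ∑' n, inner ℂ (g n) (T (f n))) inferInstance

/-- The weak-* topology on `Mult(H)`, identified via `φ ↦ M_φ` with a subalgebra of `B(H)`. -/
abbrev weakStar : TopologicalSpace (Mult H) := TopologicalSpace.induced mulOp (sigmaWeak H)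

variable {H}

/-- Weak-* continuity of a character. -/
def IsWeakStarContinuous (ρ : Character H) : Prop := @Continuous (Mult H) ℂ (weakStar H) _ ρ

/-- A bounded functional `ρ` on `H` is partially multiplicative if it is nonzero and
`ρ(f g) = ρ(f) ρ(g)` whenever `f, g ∈ H` are such that `f g ∈ H`. -/
def IsPartiallyMultiplicative (ρ : StrongDual ℂ H) : Prop :=
  ρ ≠ 0 ∧ ∀ f g h : H, (∀ x, h x = f x * g x) → ρ h = ρ f * ρ g

/-- The functional `τ` on `H` extends the character `ρ`: every multiplier belongs to `H`, and there
`τ` agrees with `ρ`. -/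
def Extends (τ : StrongDual ℂ H) (ρ : Character H) : Prop :=
  ∀ φ : Mult H, ∃ f : H, (∀ x, f x = (φ : X → ℂ) x) ∧ τ f = ρ φ

variable (H)

/-- `X` is a maximal domain for `H`: every bounded partially multiplicative functional on `H` is the
evaluation at a point of `X`. -/
def IsMaximalDomain : Prop :=
  ∀ ρ : StrongDual ℂ H, IsPartiallyMultiplicative ρ → ∃ x : X, ∀ f : H, ρ f = f x

end Defs

end PickSpace

end

noncomputable section

namespace PickSpace

open scoped InnerProductSpace ComplexConjugate Topology
open Filter Matrix

/-!
The normalized kernel `k` of a complete Pick space satisfies the McCullough–Quiggin condition that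
`1 - 1 / k` is positive semidefinite. Hence `1 - 1 / k(·, w)` is a strict contraction of `Mult(H)`,
`k(·, w)` is a multiplier, and every `f ∈ H` is a quotient `φ / (1 - ψ)` of multipliers with
`‖ψ‖ ≤ 1`, `ψ(x₀) = 0` and `‖φ‖ ≤ ‖f‖`.

If `‖ρ - δ_{x₀}‖ < 2`, then Möbius transformations yield a bound `|ρ(ψ)| ≤ r < 1` for all such `ψ`,
so the quotient representation gives `|ρ(φ)| ≤ ‖φ‖_H / (1 - r)` on the dense subspace `Mult(H)`,
and the bounded extension `τ` of `ρ` to `H` is partially multiplicative because it satisfies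
`ρ(1 - ψ) τ(f) = ρ(φ)`. Any bounded extension is a vector functional, hence weak-* continuous on
`Mult(H)`.

If `‖ρ - δ_x‖ = 2`, there are contractive multipliers `φₙ` with `φₙ(x) → 1` and
`|ρ(φₙ) - φₙ(x)| ≥ 1`. Then `φₙ k_x → k_x`, and since `Mult(H) k_x` is dense, `φₙ → 1` strongly, so
`ρ` is not weak-* continuous. Thus the weak-* continuous characters lie in the Gleason part of every
`δ_x`.
-/

section PosSemidef

variable {ι 𝕜 E F : Type*} [RCLike 𝕜] [NormedAddCommGroup E] [InnerProductSpace 𝕜 E]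
  [NormedAddCommGroup F] [InnerProductSpace 𝕜 F]

theorem sum_star_mul_gram_mul (v : ι → E) (x : ι →₀ 𝕜) :
    (x.sum fun i a ↦ x.sum fun j b ↦ star a * gram 𝕜 v i j * b) =
      ((‖Finsupp.linearCombination 𝕜 v x‖ ^ 2 : ℝ) : 𝕜) := by
  rw [RCLike.ofReal_pow, ← inner_self_eq_norm_sq_to_K, Finsupp.linearCombination_apply,
    Finsupp.sum_inner]
  simp only [Finsupp.sum, inner_sum, inner_smul_left, inner_smul_right, gram_apply,
    RCLike.star_def]
  exact Finset.sum_congr rfl fun i _ ↦ Finset.sum_congr rfl fun j _ ↦ by ring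

theorem norm_linearCombination_le_of_posSemidef {C : ℝ} (hC : 0 ≤ C) {u : ι → E} {v : ι → F}
    (h : (C ^ 2 • gram 𝕜 u - gram 𝕜 v).PosSemidef) (x : ι →₀ 𝕜) :
    ‖Finsupp.linearCombination 𝕜 v x‖ ≤ C * ‖Finsupp.linearCombination 𝕜 u x‖ := by
  have hx := h.2 x
  have hsum : (x.sum fun i a ↦ x.sum fun j b ↦ star a * (C ^ 2 • gram 𝕜 u - gram 𝕜 v) i j * b) =
      ((C ^ 2 * ‖Finsupp.linearCombination 𝕜 u x‖ ^ 2
        - ‖Finsupp.linearCombination 𝕜 v x‖ ^ 2 : ℝ) : 𝕜) := by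
    rw [RCLike.ofReal_sub, RCLike.ofReal_mul, ← sum_star_mul_gram_mul, ← sum_star_mul_gram_mul]
    simp only [Finsupp.sum, Finset.mul_sum, ← Finset.sum_sub_distrib, Matrix.sub_apply,
      Matrix.smul_apply, RCLike.real_smul_eq_coe_mul]
    exact Finset.sum_congr rfl fun i _ ↦ Finset.sum_congr rfl fun j _ ↦ by ring
  rw [hsum, RCLike.ofReal_nonneg, sub_nonneg, ← mul_pow] at hx
  exact (sq_le_sq₀ (norm_nonneg _) (by positivity)).1 hx

theorem exists_clm_of_posSemidef [CompleteSpace F] {C : ℝ} (hC : 0 ≤ C) {u : ι → E}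
    (hu : DenseRange (Finsupp.linearCombination 𝕜 u)) {v : ι → F}
    (h : (C ^ 2 • gram 𝕜 u - gram 𝕜 v).PosSemidef) :
    ∃ T : E →L[𝕜] F, (∀ i, T (u i) = v i) ∧ ‖T‖ ≤ C := by
  have hle := norm_linearCombination_le_of_posSemidef hC h
  refine ⟨(Finsupp.linearCombination 𝕜 v).extendOfNorm (Finsupp.linearCombination 𝕜 u),
    fun i ↦ ?_, LinearMap.opNorm_extendOfNorm_le hu hC hle⟩
  simpa using LinearMap.extendOfNorm_eq hu ⟨C, hle⟩ (Finsupp.single i 1)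

theorem posSemidef_gram_sub_sum_gram_comp {β : Type*} [Fintype β] {T : β → E →L[𝕜] F}
    (hT : ∀ x, ∑ b, ‖T b x‖ ^ 2 ≤ ‖x‖ ^ 2) (u : ι → E) :
    (gram 𝕜 u - ∑ b, gram 𝕜 (T b ∘ u)).PosSemidef := by
  refine ⟨(isHermitian_gram 𝕜 u).sub
    (isSelfAdjoint_sum _ fun b _ ↦ isHermitian_gram 𝕜 (T b ∘ u)), fun x ↦ ?_⟩
  have hsum : (x.sum fun i a ↦ x.sum fun j c ↦
      star a * (gram 𝕜 u - ∑ b, gram 𝕜 (T b ∘ u)) i j * c) =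
      ((‖Finsupp.linearCombination 𝕜 u x‖ ^ 2
        - ∑ b, ‖T b (Finsupp.linearCombination 𝕜 u x)‖ ^ 2 : ℝ) : 𝕜) := by
    have hcomp (b : β) : T b (Finsupp.linearCombination 𝕜 u x) =
        Finsupp.linearCombination 𝕜 (T b ∘ u) x :=
      Finsupp.apply_linearCombination 𝕜 (T b : E →ₗ[𝕜] F) u x
    simp only [hcomp, RCLike.ofReal_sub, RCLike.ofReal_sum, ← sum_star_mul_gram_mul,
      ← Finsupp.sum_finsetSum_comm, ← Finsupp.sum_sub, Matrix.sub_apply, Matrix.sum_apply, mul_sub,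
      sub_mul, Finset.mul_sum, Finset.sum_mul]
  rw [hsum, RCLike.ofReal_nonneg, sub_nonneg]
  exact hT _

theorem posSemidef_gram_kernel (u : ι → E) : (gram 𝕜 u).PosSemidef := by
  simpa using posSemidef_gram_sub_sum_gram_comp (β := Empty) (T := fun _ ↦ (0 : E →L[𝕜] E))
    (by simp) u

theorem posSemidef_of_apply_eq {R : Type*} [Ring R] [PartialOrder R] [StarRing R]
    {A B : Matrix ι ι R} (hA : A.PosSemidef) (h : ∀ i j, B i j = A i j) : B.PosSemidef :=
  Matrix.ext h ▸ hA

theorem posSemidef_of_mul_star (a : ι → 𝕜) :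
    (Matrix.of fun i j ↦ a i * star (a j)).PosSemidef := by
  convert posSemidef_gram_kernel (𝕜 := 𝕜) (E := 𝕜) fun i ↦ star (a i) using 1
  ext i j
  simp [mul_comm]

theorem posSemidef_of_forall_fin {A : Matrix ι ι 𝕜}
    (h : ∀ (n : ℕ) (z : Fin n → ι), (A.submatrix z z).PosSemidef) : A.PosSemidef := by
  refine ⟨Matrix.ext fun i j ↦ by simpa using (h 2 ![i, j]).1.apply 0 1, fun x ↦ ?_⟩
  classical
  let e := x.support.equivFin
  have hx := ((h _ fun a ↦ (e.symm a : ι)).submatrix e).2 (x.subtypeDomain (· ∈ x.support))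
  simpa [Finsupp.sum, ← Finset.sum_attach x.support, ← Finset.subtype_mem_eq_attach,
    ← Finsupp.subtypeDomain_apply, ← Finsupp.support_subtypeDomain] using hx

theorem posSemidef_of_submatrix_succ {n : ℕ} {A : Matrix (Fin (n + 1)) (Fin (n + 1)) 𝕜}
    (hrow : ∀ j, A 0 j = 0) (hcol : ∀ i, A i 0 = 0)
    (hA : (A.submatrix Fin.succ Fin.succ).PosSemidef) : A.PosSemidef := by
  refine .of_dotProduct_mulVec_nonneg (Matrix.ext fun i j ↦ ?_) fun x ↦ ?_
  · induction i using Fin.cases with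
    | zero => simp [hrow, hcol]
    | succ i =>
      induction j using Fin.cases with
      | zero => simp [hrow, hcol]
      | succ j => exact hA.1.apply i j
  · have hx := hA.dotProduct_mulVec_nonneg (x ∘ Fin.succ)
    simpa [dotProduct, mulVec, Fin.sum_univ_succ, hrow, hcol] using hx

/-- The Moore–Aronszajn theorem for scalar kernels. -/
theorem exists_gram_eq.{u} {ι : Type u} {K : Matrix ι ι ℂ} (hK : K.PosSemidef) :
    ∃ (E : Type u) (_ : NormedAddCommGroup E) (_ : InnerProductSpace ℂ E) (_ : CompleteSpace E)
      (v : ι → E), gram ℂ v = K := by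
  let K' : Matrix ι ι (ℂ →L[ℂ] ℂ) := .of fun i j ↦ K i j • ContinuousLinearMap.id ℂ ℂ
  have hK' : K'.PosSemidef := by
    have h02 := (RKHS.posSemidef_tfae (K := K')).out 0 2
    refine h02.2 ⟨Matrix.ext fun i j ↦ ?_, fun x ↦ ?_⟩
    · simp only [K', conjTranspose_apply, of_apply, star_smul, hK.1.apply i j]
      exact congrArg _ (star_one (ℂ →L[ℂ] ℂ))
    · have hx := hK.2 x
      rw [Finsupp.sum_comm] at hx
      refine (Complex.nonneg_iff.1 hx).1.trans_eq ?_
      rw [RCLike.re_eq_complex_re, ← Complex.conj_re]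
      congr 1
      simp only [Finsupp.sum, map_sum]
      refine Finset.sum_congr rfl fun i _ ↦ Finset.sum_congr rfl fun j _ ↦ ?_
      simp [K', mul_comm, mul_left_comm]
  have : Fact K'.PosSemidef := ⟨hK'⟩
  refine ⟨RKHS.OfKernel K', inferInstance, inferInstance, inferInstance,
    fun i ↦ RKHS.kerFun (RKHS.OfKernel K') i 1, Matrix.ext fun i j ↦ ?_⟩
  rw [gram_apply, RKHS.kerFun_inner, RKHS.kerFun_apply, RKHS.OfKernel.kernel_ofKernel]
  simp [K']

end PosSemidef

section Multipliers

variable {X H : Type*} [NormedAddCommGroup H] [InnerProductSpace ℂ H] [CompleteSpace H]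
  [RKHS ℂ H X ℂ]

variable (H) in
/-- The kernel function `k_x`, which represents evaluation at `x`. -/
def kfun (x : X) : H := RKHS.kerFun H x 1

@[simp]
theorem inner_kfun (x : X) (f : H) : ⟪kfun H x, f⟫_ℂ = f x := by
  simp [kfun]

theorem kfun_apply (z w : X) : kfun H w z = ker H z w := RKHS.kerFun_apply ..

theorem inner_kfun_kfun (z w : X) : ⟪kfun H z, kfun H w⟫_ℂ = ker H z w := by
  rw [inner_kfun, kfun_apply]

theorem conj_ker (z w : X) : conj (ker H z w) = ker H w z := by
  rw [← inner_kfun_kfun, inner_conj_symm, inner_kfun_kfun]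

theorem IsNormalizedAt.ker_left {x₀ : X} (hx₀ : IsNormalizedAt H x₀) (z : X) : ker H x₀ z = 1 := by
  rw [← conj_ker, hx₀ z, map_one]

theorem ker_self (x : X) : ker H x x = ((‖kfun H x‖ ^ 2 : ℝ) : ℂ) := by
  rw [← inner_kfun_kfun, inner_self_eq_norm_sq_to_K, Complex.ofReal_pow]
  rfl

variable (H) in
theorem denseRange_linearCombination_kfun :
    DenseRange (Finsupp.linearCombination ℂ (kfun H (X := X))) := by
  rw [DenseRange, ← LinearMap.coe_range, Finsupp.range_linearCombination,
    Submodule.dense_iff_topologicalClosure_eq_top, ← RKHS.kerFun_dense (𝕜 := ℂ) H (X := X) (V := ℂ)]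
  congr 1
  refine Submodule.span_eq_span (fun _ ⟨x, hx⟩ ↦ Submodule.subset_span ⟨x, 1, hx⟩) ?_
  rintro _ ⟨x, v, rfl⟩
  have hv : RKHS.kerFun H x v = v • kfun H x := by
    rw [kfun, ← map_smul, smul_eq_mul, mul_one]
  exact hv ▸ Submodule.smul_mem _ _ (Submodule.subset_span ⟨x, rfl⟩)

omit [CompleteSpace H] in
@[ext]
theorem mult_ext {φ ψ : Mult H} (h : ∀ x, (φ : X → ℂ) x = (ψ : X → ℂ) x) : φ = ψ :=
  Subtype.ext (funext h)

theorem mulOp_one : mulOp (1 : Mult H) = 1 := by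
  ext f x
  simp [mulOp_apply]

theorem mulOp_mul (φ ψ : Mult H) : mulOp (φ * ψ) = mulOp φ * mulOp ψ := by
  ext f x
  simp [mulOp_apply, mul_assoc]

variable (H) in
/-- The representation `φ ↦ M_φ` of the multiplier algebra on `H`. -/
def mulOpHom : Mult H →ₐ[ℂ] (H →L[ℂ] H) :=
  .ofLinearMap
    { toFun := mulOp
      map_add' := fun φ ψ ↦ by
        ext f x
        simp [mulOp_apply, add_mul]
      map_smul' := fun c φ ↦ by
        ext f x
        simp [mulOp_apply, mul_assoc] } mulOp_one mulOp_mul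

theorem mulOp_sub (φ ψ : Mult H) : mulOp (φ - ψ) = mulOp φ - mulOp ψ :=
  map_sub (mulOpHom H) φ ψ

theorem mulOp_smul (c : ℂ) (φ : Mult H) : mulOp (c • φ) = c • mulOp φ :=
  map_smul (mulOpHom H) c φ

theorem adjoint_mulOp_kfun (φ : Mult H) (x : X) :
    (mulOp φ).adjoint (kfun H x) = conj ((φ : X → ℂ) x) • kfun H x := by
  refine ext_inner_right ℂ fun f ↦ ?_
  rw [ContinuousLinearMap.adjoint_inner_left, inner_kfun, mulOp_apply, inner_smul_left,
    Complex.conj_conj, inner_kfun]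

theorem exists_mult_of_posSemidef {C : ℝ} (hC : 0 ≤ C) {φ : X → ℂ}
    (h : (Matrix.of fun z w ↦ ker H z w * ((C : ℂ) ^ 2 - φ z * conj (φ w))).PosSemidef) :
    ∃ Φ : Mult H, (∀ x, (Φ : X → ℂ) x = φ x) ∧ ‖mulOp Φ‖ ≤ C := by
  have hgram : (Matrix.of fun z w ↦ ker H z w * ((C : ℂ) ^ 2 - φ z * conj (φ w))) =
      C ^ 2 • gram ℂ (kfun H) - gram ℂ fun z ↦ conj (φ z) • kfun H z := by
    ext z w
    simp only [Matrix.sub_apply, Matrix.smul_apply, gram_apply, of_apply, inner_smul_left,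
      inner_smul_right, inner_kfun_kfun, Complex.conj_conj, Complex.real_smul, Complex.ofReal_pow]
    ring
  obtain ⟨T, hT, hTC⟩ := exists_clm_of_posSemidef hC (denseRange_linearCombination_kfun (X := X) H)
    (v := fun z ↦ conj (φ z) • kfun H z) (hgram ▸ h)
  have hTφ (f : H) (x : X) : T.adjoint f x = φ x * f x := by
    rw [← inner_kfun, ContinuousLinearMap.adjoint_inner_right, hT, inner_smul_left,
      Complex.conj_conj, inner_kfun]
  refine ⟨⟨φ, fun f ↦ ⟨T.adjoint f, hTφ f⟩⟩, fun _ ↦ rfl, ?_⟩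
  have : mulOp ⟨φ, fun f ↦ ⟨T.adjoint f, hTφ f⟩⟩ = T.adjoint := by
    ext f x
    rw [mulOp_apply, hTφ]
  rwa [this, LinearIsometryEquiv.norm_map]

theorem norm_map_sub_self_sq_le {𝕜 E : Type*} [RCLike 𝕜] [NormedAddCommGroup E]
    [InnerProductSpace 𝕜 E] {T : E →L[𝕜] E} (hT : ‖T‖ ≤ 1) (h : E) :
    ‖T h - h‖ ^ 2 ≤ 2 * (‖h‖ ^ 2 - RCLike.re ⟪h, T h⟫_𝕜) := by
  have hTh : ‖T h‖ ^ 2 ≤ ‖h‖ ^ 2 :=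
    pow_le_pow_left₀ (norm_nonneg _) ((T.le_opNorm h).trans
      (mul_le_of_le_one_left (norm_nonneg _) hT)) 2
  rw [norm_sub_sq (𝕜 := 𝕜), inner_re_symm]
  linarith

theorem norm_mulOp_kfun_sub_sq_le {φ : Mult H} (hφ : ‖mulOp φ‖ ≤ 1) (x : X) :
    ‖mulOp φ (kfun H x) - kfun H x‖ ^ 2 ≤ 2 * (1 - ((φ : X → ℂ) x).re) * ‖kfun H x‖ ^ 2 := by
  refine (norm_map_sub_self_sq_le hφ (kfun H x)).trans_eq ?_
  rw [inner_kfun, mulOp_apply, kfun_apply, ker_self, RCLike.re_eq_complex_re, Complex.re_mul_ofReal]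
  ring

theorem isUnit_of_isUnit_mulOp (hk : ∀ x, ker H x x ≠ 0) {φ : Mult H} (hφ : IsUnit (mulOp φ)) :
    IsUnit φ := by
  obtain ⟨u, hu⟩ := hφ
  let T : H →L[ℂ] H := ↑u⁻¹
  have hT (f : H) (x : X) : (φ : X → ℂ) x * T f x = f x := by
    rw [← mulOp_apply, ← hu, ← mul_apply_eq_comp, Units.mul_inv, one_apply_eq_self]
  have hφ0 (x : X) : (φ : X → ℂ) x ≠ 0 := fun h ↦ hk x <| by
    simpa [h, kfun_apply] using (hT (kfun H x) x).symm
  exact IsUnit.of_mul_eq_one ⟨fun x ↦ ((φ : X → ℂ) x)⁻¹, fun f ↦ ⟨T f, fun x ↦ by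
    rw [← hT f x, inv_mul_cancel_left₀ (hφ0 x)]⟩⟩ (mult_ext fun x ↦ mul_inv_cancel₀ (hφ0 x))

theorem isUnit_one_sub_of_norm_mulOp_lt_one (hk : ∀ x, ker H x x ≠ 0) {φ : Mult H}
    (hφ : ‖mulOp φ‖ < 1) : IsUnit (1 - φ) :=
  isUnit_of_isUnit_mulOp hk (by
    rw [mulOp_sub, mulOp_one]
    exact isUnit_one_sub_of_norm_lt_one hφ)

theorem norm_character_le (hk : ∀ x, ker H x x ≠ 0) (ρ : Character H) (φ : Mult H) :
    ‖ρ φ‖ ≤ ‖mulOp φ‖ := by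
  by_contra! hφ
  have hρ : ρ φ ≠ 0 := norm_pos_iff.1 ((norm_nonneg _).trans_lt hφ)
  have hunit : IsUnit (1 - (ρ φ)⁻¹ • φ) := isUnit_one_sub_of_norm_mulOp_lt_one hk <| by
    rwa [mulOp_smul, norm_smul, norm_inv, inv_mul_lt_one₀ (norm_pos_iff.2 hρ)]
  exact (hunit.map ρ).ne_zero (by simp [hρ])

end Multipliers

section Gleason

variable {X H : Type*} [NormedAddCommGroup H] [InnerProductSpace ℂ H] [CompleteSpace H]
  [RKHS ℂ H X ℂ]

theorem norm_sub_smul_le_norm_sub_smul {𝕜 E : Type*} [RCLike 𝕜] [NormedAddCommGroup E]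
    [InnerProductSpace 𝕜 E] {u v : E} (huv : ‖v‖ ≤ ‖u‖) {a : 𝕜} (ha : ‖a‖ ≤ 1) :
    ‖v - a • u‖ ≤ ‖u - conj a • v‖ := by
  refine (sq_le_sq₀ (norm_nonneg _) (norm_nonneg _)).1 (sub_nonneg.1 ?_)
  have hinner : RCLike.re ⟪v, a • u⟫_𝕜 = RCLike.re ⟪u, conj a • v⟫_𝕜 := by
    rw [inner_smul_right, inner_smul_right, ← inner_conj_symm u v, ← map_mul, RCLike.conj_re]
  have hid : ‖u - conj a • v‖ ^ 2 - ‖v - a • u‖ ^ 2 =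
      (1 - ‖a‖ ^ 2) * (‖u‖ ^ 2 - ‖v‖ ^ 2) := by
    rw [norm_sub_sq (𝕜 := 𝕜), norm_sub_sq (𝕜 := 𝕜), hinner, norm_smul, norm_smul, RCLike.norm_conj]
    ring
  rw [hid]
  exact mul_nonneg (sub_nonneg.2 (pow_le_one₀ (norm_nonneg a) ha))
    (sub_nonneg.2 (pow_le_pow_left₀ (norm_nonneg v) huv 2))

theorem exists_moebius (hk : ∀ x, ker H x x ≠ 0) {φ : Mult H} (hφ : ‖mulOp φ‖ ≤ 1) {a : ℂ}
    (ha : ‖a‖ < 1) :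
    ∃ χ : Mult H, ‖mulOp χ‖ ≤ 1 ∧ (1 - conj a • φ) * χ = φ - a • 1 := by
  obtain ⟨θ, hθ⟩ := (isUnit_one_sub_of_norm_mulOp_lt_one hk (φ := conj a • φ) (by
    rw [mulOp_smul, norm_smul, RCLike.norm_conj]
    exact (mul_le_of_le_one_right (norm_nonneg a) hφ).trans_lt ha)).exists_right_inv
  refine ⟨(φ - a • 1) * θ, ContinuousLinearMap.opNorm_le_bound _ zero_le_one fun f ↦ ?_,
    by rw [mul_left_comm, hθ, mul_one]⟩
  set h := mulOp θ f
  have hf : f = h - conj a • mulOp φ h := by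
    have := DFunLike.congr_fun (congrArg mulOp hθ) f
    rw [mulOp_mul, mulOp_sub, mulOp_smul, mulOp_one] at this
    exact this.symm
  have hχ : mulOp ((φ - a • 1) * θ) f = mulOp φ h - a • h := by
    rw [mulOp_mul, mulOp_sub, mulOp_smul, mulOp_one]
    rfl
  rw [one_mul, hχ, congrArg norm hf]
  exact norm_sub_smul_le_norm_sub_smul (((mulOp φ).le_opNorm h).trans
    (mul_le_of_le_one_left (norm_nonneg h) hφ)) ha.le

theorem norm_sub_le_charDist {ρ σ : Character H} (h : charDist ρ σ < 2) {φ : Mult H}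
    (hφ : ‖mulOp φ‖ ≤ 1) : ‖ρ φ - σ φ‖ ≤ (charDist ρ σ).toReal := by
  rw [← toReal_enorm]
  exact ENNReal.toReal_mono h.ne_top
    (le_iSup₂ (f := fun (φ : Mult H) (_ : ‖mulOp φ‖ ≤ 1) ↦ ‖ρ φ - σ φ‖ₑ) φ hφ)

/-- The image of `ρ ψ` under a Möbius transformation centred at `a = ‖ρ - σ‖ / 2` must stay within
distance `2 a` of `-a`, the image of `σ ψ = 0`. -/
theorem norm_apply_le_of_charDist_lt_two (hk : ∀ x, ker H x x ≠ 0) {ρ σ : Character H}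
    (h : charDist ρ σ < 2) {ψ : Mult H} (hψ : ‖mulOp ψ‖ ≤ 1) (hσψ : σ ψ = 0) :
    ‖ρ ψ‖ ≤ (charDist ρ σ).toReal / (1 + ((charDist ρ σ).toReal / 2) ^ 2) := by
  obtain ⟨c, hc, hct⟩ := RCLike.exists_norm_eq_mul_self (ρ ψ)
  set a := (charDist ρ σ).toReal / 2 with ha
  have ha0 : 0 ≤ a := by positivity
  have ha1 : a < 1 := by
    have := (ENNReal.toReal_lt_toReal h.ne_top ENNReal.ofNat_ne_top).2 h
    rw [ENNReal.toReal_ofNat] at this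
    linarith
  have ht1 : ‖ρ ψ‖ ≤ 1 := (norm_character_le hk ρ ψ).trans hψ
  set t := ‖ρ ψ‖
  have ht0 : 0 ≤ t := norm_nonneg _
  obtain ⟨χ, hχ, hχψ⟩ := exists_moebius hk (φ := c • ψ) (a := a)
    (by rwa [mulOp_smul, norm_smul, hc, one_mul])
    (by rwa [Complex.norm_real, Real.norm_of_nonneg ha0])
  have hρχ := congrArg ρ hχψ
  have hσχ := congrArg σ hχψ
  simp only [map_mul, map_sub, map_one, map_smul, smul_eq_mul, ← hct, hσψ, mul_zero, sub_zero,
    one_mul, mul_one, zero_sub, Complex.conj_ofReal] at hρχ hσχ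
  have hdist : ‖ρ χ + a‖ ≤ 2 * a := by
    have := norm_sub_le_charDist h hχ
    rw [hσχ, sub_neg_eq_add] at this
    linarith
  have hat : 0 < 1 - a * t := by nlinarith
  have hmoebius : ((1 - a * t : ℝ) : ℂ) * (ρ χ + a) = ((t * (1 - a ^ 2) : ℝ) : ℂ) := by
    push_cast
    rw [mul_add]
    linear_combination hρχ
  have hle : t * (1 - a ^ 2) ≤ (1 - a * t) * (2 * a) := by
    have hnorm := congrArg norm hmoebius
    rw [norm_mul, Complex.norm_real, Complex.norm_real, Real.norm_of_nonneg hat.le,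
      Real.norm_of_nonneg (mul_nonneg ht0 (by nlinarith))] at hnorm
    exact hnorm.symm.trans_le (mul_le_mul_of_nonneg_left hdist hat.le)
  rw [le_div_iff₀ (by positivity)]
  linarith

theorem exists_lt_one_forall_norm_apply_le (hk : ∀ x, ker H x x ≠ 0) {ρ σ : Character H}
    (h : charDist ρ σ < 2) :
    ∃ r < 1, ∀ ψ : Mult H, ‖mulOp ψ‖ ≤ 1 → σ ψ = 0 → ‖ρ ψ‖ ≤ r := by
  refine ⟨_, ?_, fun ψ hψ hσψ ↦ norm_apply_le_of_charDist_lt_two hk h hψ hσψ⟩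
  have hlt := (ENNReal.toReal_lt_toReal h.ne_top ENNReal.ofNat_ne_top).2 h
  rw [ENNReal.toReal_ofNat] at hlt
  rw [div_lt_one (by positivity)]
  nlinarith

theorem exists_lt_norm_sub_of_lt_charDist {ρ σ : Character H} {c : ℝ}
    (h : ENNReal.ofReal c < charDist ρ σ) :
    ∃ φ : Mult H, ‖mulOp φ‖ ≤ 1 ∧ c < ‖ρ φ - σ φ‖ ∧ σ φ = ‖σ φ‖ := by
  obtain ⟨φ, hφ, hlt⟩ := by simpa only [charDist, lt_iSup_iff, exists_prop] using h
  obtain ⟨b, hb, hbσ⟩ := RCLike.exists_norm_eq_mul_self (σ φ)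
  rw [← ofReal_norm] at hlt
  refine ⟨b • φ, by rwa [mulOp_smul, norm_smul, hb, one_mul], ?_, ?_⟩
  · rw [map_smul, map_smul, ← smul_sub, norm_smul, hb, one_mul]
    exact (ENNReal.ofReal_lt_ofReal_iff'.1 hlt).1
  · rw [map_smul, norm_smul, hb, one_mul, smul_eq_mul]
    exact hbσ.symm

theorem exists_seq_of_two_le_charDist (hk : ∀ x, ker H x x ≠ 0) {ρ σ : Character H}
    (h : 2 ≤ charDist ρ σ) :
    ∃ φ : ℕ → Mult H, (∀ n, ‖mulOp (φ n)‖ ≤ 1) ∧ Tendsto (fun n ↦ σ (φ n)) atTop (𝓝 1) ∧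
      ∀ n, 1 ≤ ‖ρ (φ n) - σ (φ n)‖ := by
  have hpos (n : ℕ) : 0 < 1 / ((n : ℝ) + 1) := Nat.one_div_pos_of_nat
  have hex (n : ℕ) := exists_lt_norm_sub_of_lt_charDist (ρ := ρ) (σ := σ)
    (c := 2 - 1 / ((n : ℝ) + 1)) <| h.trans_lt' <| by
      rw [ENNReal.ofReal_lt_iff_lt_toReal _ ENNReal.ofNat_ne_top, ENNReal.toReal_ofNat]
      · linarith [hpos n]
      · linarith [Nat.one_div_le_one_div (α := ℝ) n.zero_le]
  choose φ hφ hlt hσφ using hex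
  have hle (τ : Character H) (n : ℕ) : ‖τ (φ n)‖ ≤ 1 := (norm_character_le hk τ _).trans (hφ n)
  refine ⟨φ, hφ, ?_, fun n ↦ ?_⟩
  · have hnorm : Tendsto (fun n ↦ ‖σ (φ n)‖) atTop (𝓝 1) := by
      refine tendsto_of_tendsto_of_tendsto_of_le_of_le (g := fun n : ℕ ↦ 1 - 1 / ((n : ℝ) + 1))
        ?_ tendsto_const_nhds (fun n ↦ ?_) (hle σ)
      · simpa using (tendsto_one_div_add_atTop_nhds_zero_nat (𝕜 := ℝ)).const_sub 1
      · linarith [hlt n, hle ρ n, norm_sub_le (ρ (φ n)) (σ (φ n))]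
    rw [← Complex.ofReal_one]
    exact ((Complex.continuous_ofReal.tendsto _).comp hnorm).congr fun n ↦ (hσφ n).symm
  · linarith [hlt n, Nat.one_div_le_one_div (α := ℝ) n.zero_le]

end Gleason

section McCulloughQuiggin

variable {X H : Type*} [NormedAddCommGroup H] [InnerProductSpace ℂ H] [CompleteSpace H]
  [RKHS ℂ H X ℂ]

/-- A row `(Φ b)` of multipliers is contractive if `(f b) ↦ ∑ b, Φ b • f b` is a contraction from
the Hilbert space direct sum of copies of `H` to `H`. -/
def IsContractiveRow {β : Type*} [Fintype β] (Φ : β → Mult H) : Prop :=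
  ∀ f : β → H, ‖∑ b, mulOp (Φ b) (f b)‖ ^ 2 ≤ ∑ b, ‖f b‖ ^ 2

theorem IsContractive.isContractiveRow {r : ℕ} {Φ : Matrix (Fin r) (Fin r) (Mult H)}
    (hΦ : IsContractive Φ) (a : Fin r) : IsContractiveRow (Φ a) := fun f ↦
  (Finset.single_le_sum (f := fun a ↦ ‖∑ b, mulOp (Φ a b) (f b)‖ ^ 2) (fun _ _ ↦ sq_nonneg _)
    (Finset.mem_univ a)).trans (hΦ f)

theorem IsContractiveRow.norm_mulOp_le_one {β : Type*} [Fintype β] {Φ : β → Mult H}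
    (hΦ : IsContractiveRow Φ) (b : β) : ‖mulOp (Φ b)‖ ≤ 1 := by
  classical
  refine ContinuousLinearMap.opNorm_le_bound _ zero_le_one fun f ↦ ?_
  have hf := hΦ (Pi.single b f)
  rw [Finset.sum_eq_single b (fun c _ hc ↦ by simp [hc]) (by simp),
    Finset.sum_eq_single b (fun c _ hc ↦ by simp [hc]) (by simp), Pi.single_eq_same] at hf
  rw [one_mul]
  exact (sq_le_sq₀ (norm_nonneg _) (norm_nonneg _)).1 hf

theorem IsContractiveRow.sum_norm_adjoint_sq_le {β : Type*} [Fintype β] {Φ : β → Mult H}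
    (hΦ : IsContractiveRow Φ) (f : H) : ∑ b, ‖(mulOp (Φ b)).adjoint f‖ ^ 2 ≤ ‖f‖ ^ 2 := by
  set g : β → H := fun b ↦ (mulOp (Φ b)).adjoint f
  set S := ∑ b, ‖g b‖ ^ 2
  have hS : S ≤ ‖f‖ * ‖∑ b, mulOp (Φ b) (g b)‖ := by
    refine (le_of_eq ?_).trans (re_inner_le_norm (𝕜 := ℂ) f _)
    rw [inner_sum, map_sum]
    refine Finset.sum_congr rfl fun b _ ↦ ?_
    rw [← ContinuousLinearMap.adjoint_inner_left, inner_self_eq_norm_sq]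
  have hS0 : 0 ≤ S := Finset.sum_nonneg fun b _ ↦ sq_nonneg _
  have hSS : S * S ≤ ‖f‖ ^ 2 * S :=
    calc S * S ≤ (‖f‖ * ‖∑ b, mulOp (Φ b) (g b)‖) ^ 2 := by
          rw [← sq]
          exact pow_le_pow_left₀ hS0 hS 2
      _ ≤ ‖f‖ ^ 2 * S := by
          rw [mul_pow]
          exact mul_le_mul_of_nonneg_left (hΦ g) (sq_nonneg _)
  rcases hS0.eq_or_lt with h | h
  · exact h ▸ sq_nonneg _
  · exact le_of_mul_le_mul_right hSS h

/-- The block matrix of the interpolation problem for matrices with a single nonzero row is the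
direct sum of the scalar problem for that row and of copies of the Gram matrix of `k`. -/
theorem IsCompletePick.exists_isContractiveRow (hPick : IsCompletePick H) {n m : ℕ} {z : Fin n → X}
    {v : Fin n → Fin m → ℂ} (h : (Matrix.of fun i j ↦
      ker H (z i) (z j) * (1 - ∑ a, v i a * conj (v j a))).PosSemidef) :
    ∃ Φ : Fin m → Mult H, IsContractiveRow Φ ∧ ∀ i a, (Φ a : X → ℂ) (z i) = v i a := by
  obtain _ | m := m
  · exact ⟨Fin.elim0, fun f ↦ by simp, fun i a ↦ a.elim0⟩
  let W (i : Fin n) : Matrix (Fin (m + 1)) (Fin (m + 1)) ℂ :=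
    .of fun p q ↦ if p = 0 then v i q else 0
  have hW (i j : Fin n) (p q : Fin (m + 1)) : (W i * (W j).conjTranspose) p q =
      if p = 0 ∧ q = 0 then ∑ a, v i a * conj (v j a) else 0 := by
    by_cases hp : p = 0 <;> by_cases hq : q = 0 <;> simp [Matrix.mul_apply, W, hp, hq]
  let e : Fin (m + 1) → ℂ := Pi.single 0 1
  have hrow := (h.submatrix Prod.fst).hadamard
    ((posSemidef_vecMulVec_self_star e).submatrix (Prod.snd : Fin n × Fin (m + 1) → _))
  have he (p : Fin (m + 1)) : 0 ≤ (1 - e) p := by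
    by_cases hp : p = 0 <;> simp [e, hp]
  have hrest := ((posSemidef_gram_kernel (𝕜 := ℂ) (kfun H ∘ z)).submatrix Prod.fst).hadamard
    ((Matrix.PosSemidef.diagonal (d := 1 - e) he).submatrix
      (Prod.snd : Fin n × Fin (m + 1) → _))
  obtain ⟨Φ, hΦ, hΦW⟩ := hPick (m + 1) n z W <|
    posSemidef_of_apply_eq (hrow.add hrest) fun ⟨i, p⟩ ⟨j, q⟩ ↦ by
      by_cases hp : p = 0 <;> by_cases hq : q = 0 <;> by_cases hpq : p = q <;>
        simp_all [e, vecMulVec_apply, kfun_apply]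
  exact ⟨Φ 0, hΦ.isContractiveRow 0, fun i a ↦ by simp [hΦW, W]⟩

variable (H) in
/-- The reproducing kernel of the subspace of the functions in `H` that vanish at `y`, provided that
`k(y, y) ≠ 0`. -/
def vanishingKer (y z w : X) : ℂ := ker H z w - ker H z y * ker H y w / ker H y y

theorem gram_starProjection_kfun (y : X) :
    gram ℂ (fun z ↦ (ℂ ∙ kfun H y)ᗮ.starProjection (kfun H z)) = .of (vanishingKer H y) := by
  ext z w
  rw [gram_apply, Submodule.inner_starProjection_left_eq_right,
    Submodule.starProjection_eq_self_iff.2 (Submodule.starProjection_apply_mem _ _),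
    Submodule.starProjection_orthogonal_val, Submodule.starProjection_singleton, inner_sub_right,
    inner_smul_right, inner_kfun_kfun, inner_kfun_kfun, inner_kfun_kfun, of_apply, vanishingKer,
    ker_self y]
  simp only [Complex.coe_algebraMap]
  ring

/-- The adjoint of a multiplication operator preserves the line spanned by `k_y`, so its compression
to the orthogonal complement still acts diagonally on the projected kernel functions. -/
theorem IsContractiveRow.posSemidef_vanishingKer_mul {β : Type*} [Fintype β] {Φ : β → Mult H}
    (hΦ : IsContractiveRow Φ) (y : X) :
    (Matrix.of fun z w ↦ vanishingKer H y z w *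
      (1 - ∑ b, (Φ b : X → ℂ) z * conj ((Φ b : X → ℂ) w))).PosSemidef := by
  let P := (ℂ ∙ kfun H y)ᗮ.starProjection
  let u (z : X) : H := P (kfun H z)
  have hPy : P (kfun H y) = 0 := by
    simp only [P, Submodule.starProjection_orthogonal_val, sub_eq_zero]
    exact (Submodule.starProjection_eq_self_iff.2 (Submodule.mem_span_singleton_self _)).symm
  have hu (b : β) (z : X) : P ((mulOp (Φ b)).adjoint (u z)) = conj ((Φ b : X → ℂ) z) • u z := by
    obtain ⟨c, hc⟩ : ∃ c : ℂ, u z = kfun H z - c • kfun H y :=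
      ⟨_, by rw [← Submodule.starProjection_singleton]; exact
        Submodule.starProjection_orthogonal_val _⟩
    rw [hc, map_sub, map_smul, adjoint_mulOp_kfun, adjoint_mulOp_kfun, map_sub, map_smul, map_smul,
      map_smul, hPy, smul_zero, smul_zero, sub_zero, ← hc]
  have hle (x : H) : ∑ b, ‖(P ∘L (mulOp (Φ b)).adjoint) x‖ ^ 2 ≤ ‖x‖ ^ 2 :=
    (Finset.sum_le_sum fun b _ ↦ pow_le_pow_left₀ (norm_nonneg _)
      (Submodule.norm_starProjection_apply_le _ _) 2).trans (hΦ.sum_norm_adjoint_sq_le x)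
  have hgram : (Matrix.of fun z w ↦ vanishingKer H y z w *
      (1 - ∑ b, (Φ b : X → ℂ) z * conj ((Φ b : X → ℂ) w))) =
      gram ℂ u - ∑ b, gram ℂ ((P ∘L (mulOp (Φ b)).adjoint) ∘ u) := by
    have hv (z w : X) : vanishingKer H y z w = ⟪u z, u w⟫_ℂ :=
      congrFun₂ (gram_starProjection_kfun (H := H) y).symm z w
    ext z w
    simp only [hv, Matrix.sub_apply, Matrix.sum_apply, gram_apply, of_apply, Function.comp_apply,
      ContinuousLinearMap.comp_apply, hu, inner_smul_left, inner_smul_right, Complex.conj_conj,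
      mul_sub, mul_one, Finset.mul_sum]
    congr 1
    exact Finset.sum_congr rfl fun b _ ↦ by ring
  exact hgram ▸ posSemidef_gram_sub_sum_gram_comp hle u

theorem apply_eq_one_of_norm_mulOp_le_one {φ : Mult H} (hφ : ‖mulOp φ‖ ≤ 1) {z w : X}
    (hz : (φ : X → ℂ) z = 1) (hwz : ker H w z ≠ 0) : (φ : X → ℂ) w = 1 := by
  have hfix : mulOp φ (kfun H z) = kfun H z := by
    have := norm_mulOp_kfun_sub_sq_le hφ z
    rw [hz, Complex.one_re, sub_self, mul_zero, zero_mul] at this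
    exact sub_eq_zero.1 (norm_eq_zero.1 (pow_eq_zero_iff two_ne_zero |>.1
      (this.antisymm (sq_nonneg _))))
  have := mulOp_apply φ (kfun H z) w
  rw [hfix, kfun_apply] at this
  exact (mul_eq_right₀ hwz).1 this.symm

/-- If `k(z, w) = 0`, then some contractive multiplier is `1` at `z` and `0` at `w`, but one that is
`1` at a point is `1` at `x₀`, and hence everywhere. -/
theorem IsCompletePick.ker_ne_zero (hPick : IsCompletePick H) {x₀ : X} (hx₀ : IsNormalizedAt H x₀)
    (z w : X) : ker H z w ≠ 0 := by
  intro hzw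
  have hwz : ker H w z = 0 := by rw [← conj_ker, hzw, map_zero]
  obtain ⟨Φ, hΦ, hΦv⟩ := hPick.exists_isContractiveRow (z := ![z, w]) (m := 1)
    (v := ![fun _ ↦ 1, fun _ ↦ 0]) (by
      refine posSemidef_of_apply_eq (.diagonal (d := ![(0 : ℂ), ker H w w]) fun i ↦ ?_) fun i j ↦ ?_
      · fin_cases i
        · exact le_rfl
        · exact (ker_self (H := H) w).symm ▸ Complex.zero_le_real.2 (sq_nonneg _)
      · fin_cases i <;> fin_cases j <;> simp [hzw, hwz])
  have hφ := hΦ.norm_mulOp_le_one 0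
  have hone := apply_eq_one_of_norm_mulOp_le_one hφ
    (apply_eq_one_of_norm_mulOp_le_one hφ (hΦv 0 0) (hx₀.ker_left z ▸ one_ne_zero))
    (hx₀ w ▸ one_ne_zero)
  exact one_ne_zero (hone.symm.trans (hΦv 1 0))

/-- Factor `vanishingKer x / k` as `⟨v z, v w⟩`. The Pick property provides a contractive row with
values `v`, and compressing it to the functions vanishing at `y` moves the base point from `x` to
`y`. -/
theorem IsCompletePick.posSemidef_vanishingKer_div_of_base (hPick : IsCompletePick H)
    (hne : ∀ z w, ker H z w ≠ 0) {n : ℕ} {z : Fin n → X} {x : X}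
    (hx : (Matrix.of fun i j ↦
      vanishingKer H x (z i) (z j) / ker H (z i) (z j)).PosSemidef) (y : X) :
    (Matrix.of fun i j ↦ vanishingKer H y (z i) (z j) / ker H (z i) (z j)).PosSemidef := by
  obtain ⟨m, v, hv⟩ := Matrix.posSemidef_iff_eq_sum_vecMulVec.1 hx
  have hvsum (i j : Fin n) : 1 - ∑ a, v a i * conj (v a j) =
      ker H (z i) x * ker H x (z j) / (ker H x x * ker H (z i) (z j)) := by
    have hij := congrFun₂ hv i j
    have := hne (z i) (z j)
    have := hne x x
    rw [Matrix.sum_apply] at hij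
    simp only [of_apply, vecMulVec_apply, Pi.star_apply, RCLike.star_def] at hij
    rw [← hij, vanishingKer]
    field_simp
    ring
  have hxx : 0 ≤ ker H x x := ker_self (H := H) x ▸ Complex.zero_le_real.2 (sq_nonneg _)
  obtain ⟨Φ, hΦ, hΦv⟩ := hPick.exists_isContractiveRow (z := z) (v := fun i a ↦ v a i) <|
    posSemidef_of_apply_eq ((posSemidef_of_mul_star fun i ↦ ker H (z i) x).smul
      (inv_nonneg.2 hxx)) fun i j ↦ by
    have := hne (z i) (z j)
    simp only [of_apply, hvsum, Matrix.smul_apply, RCLike.star_def, conj_ker, smul_eq_mul]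
    field_simp
  have hrow := (posSemidef_of_mul_star fun i ↦ (ker H (z i) x)⁻¹).hadamard
    ((hΦ.posSemidef_vanishingKer_mul y).submatrix z)
  refine posSemidef_of_apply_eq (hrow.smul hxx) fun i j ↦ ?_
  have := hne (z i) (z j)
  have := hne (z i) x
  have := hne x (z j)
  have := hne x x
  simp only [of_apply, Matrix.smul_apply, hadamard_apply, submatrix_apply, hΦv, hvsum,
    RCLike.star_def, map_inv₀, conj_ker, smul_eq_mul]
  field_simp

theorem IsCompletePick.posSemidef_vanishingKer_div (hPick : IsCompletePick H)
    (hne : ∀ z w, ker H z w ≠ 0) (n : ℕ) (y : X) (z : Fin n → X) :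
    (Matrix.of fun i j ↦ vanishingKer H y (z i) (z j) / ker H (z i) (z j)).PosSemidef := by
  induction n generalizing y with
  | zero => exact posSemidef_of_apply_eq .zero fun i ↦ i.elim0
  | succ n ih =>
    refine hPick.posSemidef_vanishingKer_div_of_base hne (x := z 0) ?_ y
    refine posSemidef_of_submatrix_succ (fun j ↦ ?_) (fun i ↦ ?_) (ih (z 0) fun i ↦ z i.succ)
    · simp [vanishingKer, hne (z 0) (z 0)]
    · simp [vanishingKer, hne (z 0) (z 0)]

variable (X H) in
/-- The McCullough–Quiggin condition on the kernel `k` of `H`, which a normalized kernel satisfies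
if and only if `H` is a complete Pick space. -/
structure IsMcCulloughQuiggin : Prop where
  ker_ne_zero (z w : X) : ker H z w ≠ 0
  posSemidef_one_sub_inv : (Matrix.of fun z w : X ↦ 1 - (ker H z w)⁻¹).PosSemidef

theorem IsCompletePick.isMcCulloughQuiggin (hPick : IsCompletePick H) {x₀ : X}
    (hx₀ : IsNormalizedAt H x₀) : IsMcCulloughQuiggin X H := by
  have hne := hPick.ker_ne_zero hx₀
  refine ⟨hne, posSemidef_of_forall_fin fun n z ↦ ?_⟩
  refine posSemidef_of_apply_eq (hPick.posSemidef_vanishingKer_div hne n x₀ z) fun i j ↦ ?_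
  have := hne (z i) (z j)
  simp only [submatrix_apply, of_apply, vanishingKer, hx₀ _, hx₀.ker_left]
  field_simp

end McCulloughQuiggin

section Shift

universe u v

variable {X : Type u} {H : Type v} [NormedAddCommGroup H] [InnerProductSpace ℂ H] [CompleteSpace H]
  [RKHS ℂ H X ℂ]

namespace IsMcCulloughQuiggin

/-- Write `1 - 1 / k(z, w) = ⟨b z, b w⟩`. Then `V w f` stands for `b w ⊗ f`, and `R` is
multiplication by the row `z ↦ ⟨b z, ·⟩`, the adjoint of `k_z ↦ b z ⊗ k_z`. -/
theorem exists_rowOperator (h : IsMcCulloughQuiggin X H) :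
    ∃ (E : Type (max u v)) (_ : NormedAddCommGroup E) (_ : InnerProductSpace ℂ E)
      (V : X → H → E) (R : E →L[ℂ] H),
      (∀ z f w g, ⟪V z f, V w g⟫_ℂ = (1 - (ker H z w)⁻¹) * ⟪f, g⟫_ℂ) ∧ ‖R‖ ≤ 1 ∧
        ∀ w f z, R (V w f) z = (1 - (ker H z w)⁻¹) * f z := by
  obtain ⟨E, _, _, _, V, hV⟩ := exists_gram_eq <|
    (h.posSemidef_one_sub_inv.submatrix (Prod.fst : X × H → X)).hadamard
      (posSemidef_gram_kernel Prod.snd)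
  have hV (p q : X × H) : ⟪V p, V q⟫_ℂ = (1 - (ker H p.1 q.1)⁻¹) * ⟪p.2, q.2⟫_ℂ :=
    congrFun₂ hV p q
  obtain ⟨T, hT, hT1⟩ := exists_clm_of_posSemidef zero_le_one
    (denseRange_linearCombination_kfun (X := X) H) (v := fun z ↦ V (z, kfun H z)) <|
    posSemidef_of_apply_eq (posSemidef_of_mul_star fun _ : X ↦ (1 : ℂ)) fun z w ↦ by
      have := h.ker_ne_zero z w
      simp only [one_pow, one_smul, Matrix.sub_apply, gram_apply, inner_kfun_kfun, hV, of_apply,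
        star_one, mul_one]
      field_simp
      ring
  refine ⟨E, inferInstance, inferInstance, fun z f ↦ V (z, f), T.adjoint, fun z f w g ↦ hV _ _,
    (LinearIsometryEquiv.norm_map _ T).trans_le hT1, fun w f z ↦ ?_⟩
  rw [← inner_kfun, ContinuousLinearMap.adjoint_inner_right, hT, hV, inner_kfun]

/-- The multiplier `1 - 1 / k(·, w)`, whose Neumann series sums to `k(·, w)`. -/
def shift (h : IsMcCulloughQuiggin X H) (w : X) : Mult H :=
  ⟨fun z ↦ 1 - (ker H z w)⁻¹, fun f ↦ by
    obtain ⟨E, _, _, V, R, -, -, hRV⟩ := h.exists_rowOperator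
    exact ⟨R (V w f), hRV w f⟩⟩

theorem mulOp_shift_apply (h : IsMcCulloughQuiggin X H) (w : X) (f : H) (z : X) :
    mulOp (h.shift w) f z = (1 - (ker H z w)⁻¹) * f z :=
  mulOp_apply ..

theorem norm_mulOp_shift_lt_one (h : IsMcCulloughQuiggin X H) (w : X) :
    ‖mulOp (h.shift w)‖ < 1 := by
  obtain ⟨E, _, _, V, R, hV, hR, hRV⟩ := h.exists_rowOperator
  have hk : 0 < ‖kfun H w‖ ^ 2 := (sq_nonneg _).lt_of_ne' fun h0 ↦
    h.ker_ne_zero w w (by rw [ker_self, h0, Complex.ofReal_zero])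
  have hVf (f : H) : ‖V w f‖ ^ 2 = (1 - (‖kfun H w‖ ^ 2)⁻¹) * ‖f‖ ^ 2 := by
    have := hV w f w f
    rw [inner_self_eq_norm_sq_to_K, inner_self_eq_norm_sq_to_K, ker_self] at this
    simp only [Complex.coe_algebraMap] at this
    exact_mod_cast this
  refine (ContinuousLinearMap.opNorm_le_bound _ (Real.sqrt_nonneg (1 - (‖kfun H w‖ ^ 2)⁻¹))
    fun f ↦ ?_).trans_lt ((Real.sqrt_lt' one_pos).2 (by simpa using hk))
  calc ‖mulOp (h.shift w) f‖ = ‖R (V w f)‖ :=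
        congrArg norm (RKHS.ext fun z ↦ by rw [mulOp_shift_apply, hRV])
    _ ≤ ‖V w f‖ := (R.le_opNorm _).trans (mul_le_of_le_one_left (norm_nonneg _) hR)
    _ = √(1 - (‖kfun H w‖ ^ 2)⁻¹) * ‖f‖ := by
        rw [← Real.sqrt_sq (norm_nonneg (V w f)), hVf, Real.sqrt_mul' _ (sq_nonneg _),
          Real.sqrt_sq (norm_nonneg f)]

theorem posSemidef_inner_sub_inner_shift (h : IsMcCulloughQuiggin X H) (F : X → H) :
    (Matrix.of fun z w ↦ (1 - (ker H z w)⁻¹) * ⟪F z, F w⟫_ℂ -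
      ⟪mulOp (h.shift z) (F z), mulOp (h.shift w) (F w)⟫_ℂ).PosSemidef := by
  obtain ⟨E, _, _, V, R, hV, hR, hRV⟩ := h.exists_rowOperator
  have hRle (x : E) : ∑ _ : Unit, ‖R x‖ ^ 2 ≤ ‖x‖ ^ 2 := by
    rw [Fintype.sum_unique]
    exact pow_le_pow_left₀ (norm_nonneg _)
      ((R.le_opNorm _).trans (mul_le_of_le_one_left (norm_nonneg _) hR)) 2
  have hshift (w : X) : mulOp (h.shift w) (F w) = R (V w (F w)) :=
    RKHS.ext fun z ↦ by rw [mulOp_shift_apply, hRV]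
  refine posSemidef_of_apply_eq (posSemidef_gram_sub_sum_gram_comp hRle fun z ↦ V z (F z))
    fun z w ↦ ?_
  simp [gram_apply, hV, hshift]

/-- The kernel function `k(·, w)`, regarded as a multiplier. -/
def kerMult (h : IsMcCulloughQuiggin X H) (w : X) : Mult H :=
  ⟨fun z ↦ ker H z w, by
    obtain ⟨θ, hθ⟩ := (isUnit_one_sub_of_norm_mulOp_lt_one (fun x ↦ h.ker_ne_zero x x)
      (h.norm_mulOp_shift_lt_one w)).exists_right_inv
    convert θ.2 with z
    have hz : (1 - (1 - (ker H z w)⁻¹)) * (θ : X → ℂ) z = 1 := congrFun (congrArg Subtype.val hθ) z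
    rw [sub_sub_cancel, inv_mul_eq_iff_eq_mul₀ (h.ker_ne_zero z w), mul_one] at hz
    exact hz.symm⟩

theorem mulOp_kerMult_apply (h : IsMcCulloughQuiggin X H) (w : X) (f : H) (z : X) :
    mulOp (h.kerMult w) f z = ker H z w * f z :=
  mulOp_apply ..

theorem mulOp_shift_mulOp_kerMult (h : IsMcCulloughQuiggin X H) (w : X) (f : H) :
    mulOp (h.shift w) (mulOp (h.kerMult w) f) = mulOp (h.kerMult w) f - f := by
  ext z
  have := h.ker_ne_zero z w
  rw [mulOp_shift_apply, RKHS.coe_sub, Pi.sub_apply, mulOp_kerMult_apply]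
  field_simp

theorem posSemidef_ker_mul_inner (h : IsMcCulloughQuiggin X H) (e : X → H) :
    (Matrix.of fun z w ↦ ker H z w * (⟪mulOp (h.kerMult z) (e z), e w⟫_ℂ +
      ⟪e z, mulOp (h.kerMult w) (e w)⟫_ℂ - ⟪e z, e w⟫_ℂ)).PosSemidef := by
  let F (z : X) : H := mulOp (h.kerMult z) (e z)
  have hF (z : X) : mulOp (h.shift z) (F z) = F z - e z := h.mulOp_shift_mulOp_kerMult z (e z)
  refine posSemidef_of_apply_eq ((posSemidef_gram_kernel F).add
    ((posSemidef_gram_kernel (kfun H)).hadamard (h.posSemidef_inner_sub_inner_shift F)))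
    fun z w ↦ ?_
  have := h.ker_ne_zero z w
  simp only [Matrix.add_apply, hadamard_apply, of_apply, gram_apply, inner_kfun_kfun, hF,
    inner_sub_left, inner_sub_right]
  field_simp
  ring

end IsMcCulloughQuiggin

end Shift

section Factorization

variable {X H : Type*} [NormedAddCommGroup H] [InnerProductSpace ℂ H] [CompleteSpace H]
  [RKHS ℂ H X ℂ] {x₀ : X}

theorem IsNormalizedAt.kfun_apply (hx₀ : IsNormalizedAt H x₀) (z : X) : kfun H x₀ z = 1 :=
  (PickSpace.kfun_apply z x₀).trans (hx₀ z)

theorem IsNormalizedAt.mulOp_kfun_apply (hx₀ : IsNormalizedAt H x₀) (φ : Mult H) (z : X) :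
    mulOp φ (kfun H x₀) z = (φ : X → ℂ) z := by
  rw [mulOp_apply, hx₀.kfun_apply, mul_one]

namespace IsMcCulloughQuiggin

theorem mulOp_kerMult_kfun (h : IsMcCulloughQuiggin X H) (hx₀ : IsNormalizedAt H x₀) (w : X) :
    mulOp (h.kerMult w) (kfun H x₀) = kfun H w := by
  ext z
  rw [mulOp_kerMult_apply, hx₀.kfun_apply, mul_one, kfun_apply]

/-- The function `u z = ⟨f k_z, f⟩`. The Sarason function of `f` is `2 u - ‖f‖²`. -/
def kerPairing (h : IsMcCulloughQuiggin X H) (f : H) (z : X) : ℂ := ⟪mulOp (h.kerMult z) f, f⟫_ℂ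

theorem kerPairing_base (h : IsMcCulloughQuiggin X H) (hx₀ : IsNormalizedAt H x₀) (f : H) :
    h.kerPairing f x₀ = ‖f‖ ^ 2 := by
  have hf : mulOp (h.kerMult x₀) f = f := by
    ext z
    rw [mulOp_kerMult_apply, hx₀, one_mul]
  rw [kerPairing, hf]
  exact inner_self_eq_norm_sq_to_K f

theorem posSemidef_ker_mul_kerPairing (h : IsMcCulloughQuiggin X H) (hx₀ : IsNormalizedAt H x₀)
    (f : H) (a b : X → ℂ) :
    (Matrix.of fun z w ↦ ker H z w * (conj (a z) * a w *
      (h.kerPairing f z + conj (h.kerPairing f w) - ‖f‖ ^ 2) + conj (a z) * b w * conj (f w) +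
        conj (b z) * a w * f z + conj (b z) * b w)).PosSemidef := by
  refine posSemidef_of_apply_eq
    (h.posSemidef_ker_mul_inner fun z ↦ a z • f + b z • kfun H x₀) fun z w ↦ ?_
  have hinner (g : H) (x : X) : ⟪g, kfun H x⟫_ℂ = conj (g x) := by
    rw [← inner_conj_symm, inner_kfun]
  have hff : (‖f‖ : ℂ) ^ 2 = ⟪f, f⟫_ℂ := (inner_self_eq_norm_sq_to_K f).symm
  have hbase (z : X) : mulOp (h.kerMult z) f x₀ = f x₀ := by
    rw [mulOp_kerMult_apply, hx₀.ker_left, one_mul]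
  simp only [of_apply, kerPairing, hff, map_add, map_smul, h.mulOp_kerMult_kfun hx₀, inner_add_left,
    inner_add_right, inner_smul_left, inner_smul_right, inner_kfun, hinner, RKHS.coe_add,
    RKHS.coe_smul, Pi.add_apply, Pi.smul_apply, smul_eq_mul, hx₀.kfun_apply, kfun_apply,
    hx₀.ker_left, hbase, map_mul, map_one, inner_conj_symm]
  ring

theorem kerPairing_ne_zero (h : IsMcCulloughQuiggin X H) (hx₀ : IsNormalizedAt H x₀) {f : H}
    (hf : f ≠ 0) (z : X) : h.kerPairing f z ≠ 0 := by
  intro hz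
  have hdiag := (h.posSemidef_ker_mul_kerPairing hx₀ f 1 0).diag_nonneg (i := z)
  have hle : 0 ≤ ‖kfun H z‖ ^ 2 * -‖f‖ ^ 2 := by
    rw [← Complex.zero_le_real]
    simpa [hz, ker_self] using hdiag
  have hk : 0 < ‖kfun H z‖ ^ 2 := (sq_nonneg _).lt_of_ne' fun h0 ↦
    h.ker_ne_zero z z (by rw [ker_self, h0, Complex.ofReal_zero])
  exact (pow_pos (norm_pos_iff.2 hf) 2).not_ge <|
    neg_nonneg.1 ((mul_nonneg_iff_of_pos_left hk).1 hle)

theorem exists_mult_one_sub_div_kerPairing (h : IsMcCulloughQuiggin X H)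
    (hx₀ : IsNormalizedAt H x₀) {f : H} (hf : f ≠ 0) :
    ∃ ψ : Mult H, (∀ z, (ψ : X → ℂ) z = 1 - ‖f‖ ^ 2 / h.kerPairing f z) ∧ ‖mulOp ψ‖ ≤ 1 := by
  refine exists_mult_of_posSemidef zero_le_one <| posSemidef_of_apply_eq
    (h.posSemidef_ker_mul_kerPairing hx₀ f (fun z ↦ ‖f‖ / conj (h.kerPairing f z)) 0) fun z w ↦ ?_
  have := h.kerPairing_ne_zero hx₀ hf z
  have : conj (h.kerPairing f w) ≠ 0 := (map_ne_zero _).2 (h.kerPairing_ne_zero hx₀ hf w)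
  simp only [of_apply, map_sub, map_one, map_div₀, map_pow, Complex.conj_conj,
    Complex.conj_ofReal, Complex.ofReal_one, Pi.zero_apply, map_zero]
  field_simp
  ring

theorem exists_mult_mul_div_kerPairing (h : IsMcCulloughQuiggin X H) (hx₀ : IsNormalizedAt H x₀)
    {f : H} (hf : f ≠ 0) :
    ∃ φ : Mult H, (∀ z, (φ : X → ℂ) z = ‖f‖ ^ 2 / h.kerPairing f z * f z) ∧ ‖mulOp φ‖ ≤ ‖f‖ := by
  refine exists_mult_of_posSemidef (norm_nonneg f) <| posSemidef_of_apply_eq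
    (h.posSemidef_ker_mul_kerPairing hx₀ f
      (fun z ↦ -(‖f‖ * conj (f z) / conj (h.kerPairing f z))) fun _ ↦ ‖f‖) fun z w ↦ ?_
  have := h.kerPairing_ne_zero hx₀ hf z
  have : conj (h.kerPairing f w) ≠ 0 := (map_ne_zero _).2 (h.kerPairing_ne_zero hx₀ hf w)
  simp only [of_apply, map_neg, map_mul, map_div₀, map_pow, Complex.conj_conj, Complex.conj_ofReal]
  field_simp
  ring

theorem exists_factorization (h : IsMcCulloughQuiggin X H) (hx₀ : IsNormalizedAt H x₀) (f : H) :
    ∃ ψ φ : Mult H, ‖mulOp ψ‖ ≤ 1 ∧ (ψ : X → ℂ) x₀ = 0 ∧ ‖mulOp φ‖ ≤ ‖f‖ ∧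
      mulOp (1 - ψ) f = mulOp φ (kfun H x₀) := by
  rcases eq_or_ne f 0 with rfl | hf
  · have h0 : mulOp (0 : Mult H) = 0 := map_zero (mulOpHom H)
    exact ⟨0, 0, by simp [h0], rfl, by simp [h0], by simp [h0]⟩
  obtain ⟨ψ, hψ, hψ1⟩ := h.exists_mult_one_sub_div_kerPairing hx₀ hf
  obtain ⟨φ, hφ, hφf⟩ := h.exists_mult_mul_div_kerPairing hx₀ hf
  refine ⟨ψ, φ, hψ1, ?_, hφf, RKHS.ext fun z ↦ ?_⟩
  · have hf2 : (‖f‖ : ℂ) ^ 2 ≠ 0 :=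
      pow_ne_zero 2 (Complex.ofReal_ne_zero.2 (norm_ne_zero_iff.2 hf))
    rw [hψ, h.kerPairing_base hx₀, div_self hf2, sub_self]
  · rw [hx₀.mulOp_kfun_apply, hφ, mulOp_sub, mulOp_one, _root_.sub_apply,
      RKHS.coe_sub, Pi.sub_apply, one_apply_eq_self, mulOp_apply, hψ]
    ring

end IsMcCulloughQuiggin

end Factorization

section Extension

variable {X H : Type*} [NormedAddCommGroup H] [InnerProductSpace ℂ H] [CompleteSpace H]
  [RKHS ℂ H X ℂ]

/-- The orbit map `φ ↦ φ f` of a vector `f` under the multiplier algebra. If the kernel is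
normalized at `x₀`, the vector `kfun H x₀` is the function `1` and its orbit map is the inclusion of
`Mult(H)` into `H`. -/
def orbit (f : H) : Mult H →ₗ[ℂ] H :=
  (ContinuousLinearMap.apply ℂ H f).toLinearMap ∘ₗ (mulOpHom H).toLinearMap

theorem orbit_apply (f : H) (φ : Mult H) : orbit f φ = mulOp φ f := rfl

theorem mulOp_orbit (φ ψ : Mult H) (f : H) : mulOp φ (orbit f ψ) = orbit f (φ * ψ) := by
  rw [orbit_apply, orbit_apply, mulOp_mul, mul_apply_eq_comp]

theorem IsMcCulloughQuiggin.denseRange_orbit_kfun (h : IsMcCulloughQuiggin X H) (x : X) :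
    DenseRange (orbit (kfun H x)) := by
  have hkfun (w : X) : orbit (kfun H x) (h.kerMult w * (1 - h.shift x)) = kfun H w := by
    ext z
    have := h.ker_ne_zero z x
    rw [← mulOp_orbit, mulOp_kerMult_apply, orbit_apply, mulOp_sub, mulOp_one, _root_.sub_apply,
      RKHS.coe_sub, Pi.sub_apply, one_apply_eq_self, mulOp_shift_apply, kfun_apply, kfun_apply]
    field_simp
    ring
  refine (denseRange_linearCombination_kfun (X := X) H).mono ?_
  rintro _ ⟨c, rfl⟩
  refine ⟨Finsupp.linearCombination ℂ (fun w ↦ h.kerMult w * (1 - h.shift x)) c, ?_⟩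
  rw [Finsupp.apply_linearCombination]
  exact congrArg (fun v ↦ Finsupp.linearCombination ℂ v c) (funext hkfun)

variable {x₀ : X} {ρ : Character H} {τ : StrongDual ℂ H}

theorem IsNormalizedAt.extends_iff (hx₀ : IsNormalizedAt H x₀) :
    Extends τ ρ ↔ ∀ φ, τ (orbit (kfun H x₀) φ) = ρ φ := by
  refine ⟨fun hτ φ ↦ ?_, fun hτ φ ↦ ⟨orbit (kfun H x₀) φ, hx₀.mulOp_kfun_apply φ, hτ φ⟩⟩
  obtain ⟨f, hf, hfφ⟩ := hτ φ
  rw [← hfφ]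
  exact congrArg τ (RKHS.ext fun z ↦ (hx₀.mulOp_kfun_apply φ z).trans (hf z).symm)

namespace IsMcCulloughQuiggin

theorem norm_apply_le_of_base (h : IsMcCulloughQuiggin X H) (hx₀ : IsNormalizedAt H x₀) {r : ℝ}
    (hr : r < 1) (hρ : ∀ ψ : Mult H, ‖mulOp ψ‖ ≤ 1 → (ψ : X → ℂ) x₀ = 0 → ‖ρ ψ‖ ≤ r)
    (φ : Mult H) : ‖ρ φ‖ ≤ (1 - r)⁻¹ * ‖orbit (kfun H x₀) φ‖ := by
  obtain ⟨ψ, θ, hψ, hψ0, hθ, hfac⟩ := h.exists_factorization hx₀ (orbit (kfun H x₀) φ)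
  have hmul : (1 - ψ) * φ = θ := mult_ext fun z ↦ by
    rw [← hx₀.mulOp_kfun_apply, ← hx₀.mulOp_kfun_apply θ, ← hfac, mulOp_orbit, orbit_apply]
  have hψr : 1 - r ≤ ‖ρ (1 - ψ)‖ := by
    have := norm_sub_norm_le (1 : ℂ) (ρ ψ)
    rw [norm_one] at this
    rw [map_sub, map_one]
    linarith [hρ ψ hψ hψ0]
  rw [le_inv_mul_iff₀ (sub_pos.2 hr)]
  calc (1 - r) * ‖ρ φ‖ ≤ ‖ρ (1 - ψ)‖ * ‖ρ φ‖ := by gcongr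
    _ = ‖ρ θ‖ := by rw [← norm_mul, ← map_mul, hmul]
    _ ≤ ‖mulOp θ‖ := norm_character_le (fun x ↦ h.ker_ne_zero x x) ρ θ
    _ ≤ ‖orbit (kfun H x₀) φ‖ := hθ

theorem map_mulOp_of_extends (h : IsMcCulloughQuiggin X H) (hx₀ : IsNormalizedAt H x₀)
    (hτ : Extends τ ρ) (φ : Mult H) (f : H) : τ (mulOp φ f) = ρ φ * τ f := by
  rw [hx₀.extends_iff] at hτ
  refine (h.denseRange_orbit_kfun x₀).induction (P := fun f ↦ τ (mulOp φ f) = ρ φ * τ f) ?_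
    (isClosed_eq (by fun_prop) (by fun_prop)) f
  rintro _ ⟨ψ, rfl⟩
  rw [mulOp_orbit, hτ, hτ, map_mul]

theorem isPartiallyMultiplicative_of_extends (h : IsMcCulloughQuiggin X H)
    (hx₀ : IsNormalizedAt H x₀) (hτ : Extends τ ρ)
    (hρ : ∀ ψ : Mult H, ‖mulOp ψ‖ ≤ 1 → (ψ : X → ℂ) x₀ = 0 → ρ ψ ≠ 1) :
    IsPartiallyMultiplicative τ := by
  have hmul := h.map_mulOp_of_extends hx₀ hτ
  have hτ' := hx₀.extends_iff.1 hτ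
  refine ⟨fun h0 ↦ ?_, fun f g p hp ↦ ?_⟩
  · have := hτ' 1
    simp [h0] at this
  obtain ⟨ψ, φ, hψ, hψ0, -, hfac⟩ := h.exists_factorization hx₀ f
  have hρψ : ρ (1 - ψ) ≠ 0 := by
    rw [map_sub, map_one]
    exact sub_ne_zero.2 (hρ ψ hψ hψ0).symm
  have hprod : mulOp (1 - ψ) p = mulOp φ g := by
    ext z
    rw [mulOp_apply, hp, ← mul_assoc, ← mulOp_apply, hfac, hx₀.mulOp_kfun_apply, mulOp_apply]
  refine mul_left_cancel₀ hρψ ?_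
  calc ρ (1 - ψ) * τ p = ρ φ * τ g := by rw [← hmul, hprod, hmul]
    _ = τ (mulOp (1 - ψ) f) * τ g := by rw [hfac, ← orbit_apply, hτ']
    _ = ρ (1 - ψ) * (τ f * τ g) := by rw [hmul, mul_assoc]

theorem exists_extension (h : IsMcCulloughQuiggin X H) (hx₀ : IsNormalizedAt H x₀)
    (hρ : ρ ∈ gleasonPart (evalChar H x₀)) :
    ∃ τ : StrongDual ℂ H, IsPartiallyMultiplicative τ ∧ Extends τ ρ := by
  obtain ⟨r, hr, hρr⟩ :=
    exists_lt_one_forall_norm_apply_le (fun x ↦ h.ker_ne_zero x x) hρ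
  have hbound := h.norm_apply_le_of_base hx₀ hr hρr
  have hext : Extends (ρ.toLinearMap.extendOfNorm (orbit (kfun H x₀))) ρ :=
    hx₀.extends_iff.2 <| LinearMap.extendOfNorm_eq (h.denseRange_orbit_kfun x₀) ⟨_, hbound⟩
  refine ⟨_, h.isPartiallyMultiplicative_of_extends hx₀ hext fun ψ hψ hψ0 h1 ↦ ?_, hext⟩
  have := hρr ψ hψ hψ0
  rw [h1, norm_one] at this
  exact hr.not_ge this

end IsMcCulloughQuiggin

end Extension

section WeakStar

variable {X H : Type*} [NormedAddCommGroup H] [InnerProductSpace ℂ H] [CompleteSpace H]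
  [RKHS ℂ H X ℂ] {ρ : Character H}

theorem IsNormalizedAt.isWeakStarContinuous_of_extends {x₀ : X} (hx₀ : IsNormalizedAt H x₀)
    {τ : StrongDual ℂ H} (hτ : Extends τ ρ) : IsWeakStarContinuous ρ := by
  let F : lp (fun _ : ℕ ↦ H) 2 := lp.single 2 0 (kfun H x₀)
  let G : lp (fun _ : ℕ ↦ H) 2 := lp.single 2 0 ((InnerProductSpace.toDual ℂ H).symm τ)
  have hρ : (ρ : Mult H → ℂ) = (fun T : H →L[ℂ] H ↦ ∑' n, ⟪G n, T (F n)⟫_ℂ) ∘ mulOp := by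
    funext φ
    rw [← hx₀.extends_iff.1 hτ, Function.comp_apply, tsum_eq_single 0 fun n hn ↦ by simp [F, hn]]
    simp [F, G, orbit_apply]
  rw [IsWeakStarContinuous, hρ]
  exact @Continuous.comp _ _ _ (weakStar H) (sigmaWeak H) _ _ _
    (continuous_iInf_dom (i := F) (continuous_iInf_dom (i := G) continuous_induced_dom))
    continuous_induced_dom

theorem IsWeakStarContinuous.tendsto (hρ : IsWeakStarContinuous ρ) {φ : ℕ → Mult H} {ψ : Mult H}
    (hφ : ∀ n, ‖mulOp (φ n)‖ ≤ 1)
    (hlim : ∀ f : H, Tendsto (fun n ↦ mulOp (φ n) f) atTop (𝓝 (mulOp ψ f))) :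
    Tendsto (fun n ↦ ρ (φ n)) atTop (𝓝 (ρ ψ)) := by
  suffices Tendsto φ atTop (@nhds _ (weakStar H) ψ) from
    (@Continuous.tendsto _ _ (weakStar H) _ _ hρ ψ).comp this
  simp only [nhds_induced, nhds_iInf, tendsto_iInf, tendsto_comap_iff]
  intro F G
  have hsum : Summable fun n ↦ ‖G n‖ * ‖F n‖ :=
    lp.summable_mul (by simpa using Real.HolderConjugate.two_two) G F
  refine tendsto_tsum_of_dominated_convergence hsum (fun n ↦ tendsto_const_nhds.inner (hlim (F n)))
    (Eventually.of_forall fun m n ↦ (norm_inner_le_norm _ _).trans ?_)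
  gcongr
  exact ((mulOp (φ m)).le_of_opNorm_le (hφ m) _).trans_eq (one_mul _)

theorem tendsto_mulOp_kfun {φ : ℕ → Mult H} (hφ : ∀ n, ‖mulOp (φ n)‖ ≤ 1) {x : X}
    (hlim : Tendsto (fun n ↦ (φ n : X → ℂ) x) atTop (𝓝 1)) :
    Tendsto (fun n ↦ mulOp (φ n) (kfun H x)) atTop (𝓝 (kfun H x)) := by
  have hsq : Tendsto (fun n ↦ ‖mulOp (φ n) (kfun H x) - kfun H x‖ ^ 2) atTop (𝓝 0) := by
    refine squeeze_zero (fun n ↦ sq_nonneg _) (fun n ↦ norm_mulOp_kfun_sub_sq_le (hφ n) x) ?_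
    simpa using ((((Complex.continuous_re.tendsto 1).comp hlim).const_sub 1).const_mul 2).mul_const
      (‖kfun H x‖ ^ 2)
  rw [tendsto_iff_norm_sub_tendsto_zero]
  simpa [Function.comp_def, Real.sqrt_sq] using (Real.continuous_sqrt.tendsto _).comp hsq

namespace IsMcCulloughQuiggin

theorem tendsto_mulOp (h : IsMcCulloughQuiggin X H) {φ : ℕ → Mult H}
    (hφ : ∀ n, ‖mulOp (φ n)‖ ≤ 1) {x : X}
    (hlim : Tendsto (fun n ↦ (φ n : X → ℂ) x) atTop (𝓝 1)) (f : H) :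
    Tendsto (fun n ↦ mulOp (φ n) f) atTop (𝓝 f) := by
  have hequi : Equicontinuous fun n ↦ (mulOp (φ n) : H → H) :=
    (LipschitzWith.uniformEquicontinuous (fun n ↦ (mulOp (φ n) : H → H)) 1 fun n ↦
      (mulOp (φ n)).lipschitzWith_of_opNorm_le (hφ n)).equicontinuous
  refine (h.denseRange_orbit_kfun x).induction
    (P := fun f ↦ Tendsto (fun n ↦ mulOp (φ n) f) atTop (𝓝 f)) ?_
    (hequi.isClosed_setOfPred_tendsto continuous_id) f
  rintro _ ⟨ψ, rfl⟩
  have hcomm (n : ℕ) : mulOp (φ n) (orbit (kfun H x) ψ) = mulOp ψ (mulOp (φ n) (kfun H x)) := by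
    rw [mulOp_orbit, mul_comm, ← mulOp_orbit, orbit_apply]
  simp_rw [hcomm]
  exact ((mulOp ψ).continuous.tendsto _).comp (tendsto_mulOp_kfun hφ hlim)

theorem mem_gleasonPart_evalChar (h : IsMcCulloughQuiggin X H) (hρ : IsWeakStarContinuous ρ)
    (x : X) : ρ ∈ gleasonPart (evalChar H x) := by
  by_contra hge
  obtain ⟨φ, hφ, hlim, hdist⟩ :=
    exists_seq_of_two_le_charDist (fun x ↦ h.ker_ne_zero x x) (not_lt.1 hge)
  have hρlim : Tendsto (fun n ↦ ρ (φ n)) atTop (𝓝 1) := by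
    rw [← map_one ρ]
    refine hρ.tendsto hφ fun f ↦ ?_
    rw [mulOp_one, one_apply_eq_self]
    exact h.tendsto_mulOp hφ hlim f
  have hdiff := (hρlim.sub hlim).norm
  rw [sub_self, norm_zero] at hdiff
  exact not_lt_of_ge (ge_of_tendsto' hdiff hdist) one_pos

end IsMcCulloughQuiggin

end WeakStar

section MaximalDomain

variable {X H : Type*} [NormedAddCommGroup H] [InnerProductSpace ℂ H] [CompleteSpace H]
  [RKHS ℂ H X ℂ] {x₀ : X}

theorem mem_gleasonPart_self (ρ : Character H) : ρ ∈ gleasonPart ρ := by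
  have : charDist ρ ρ = 0 := by simp [charDist]
  exact this.trans_lt two_pos

namespace IsNormalizedAt

theorem extends_innerSL_kfun (hx₀ : IsNormalizedAt H x₀) (x : X) :
    Extends (innerSL ℂ (kfun H x)) (evalChar H x) :=
  hx₀.extends_iff.2 fun φ ↦ (inner_kfun x _).trans (hx₀.mulOp_kfun_apply φ x)

theorem isWeakStarContinuous_evalChar (hx₀ : IsNormalizedAt H x₀) (x : X) :
    IsWeakStarContinuous (evalChar H x) :=
  hx₀.isWeakStarContinuous_of_extends (hx₀.extends_innerSL_kfun x)

theorem exists_extends (hx₀ : IsNormalizedAt H x₀) {τ : StrongDual ℂ H}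
    (hτ : IsPartiallyMultiplicative τ) : ∃ ρ : Character H, Extends τ ρ := by
  obtain ⟨h0, hmul⟩ := hτ
  obtain ⟨f, hf⟩ := DFunLike.exists_ne h0
  have hone : τ (orbit (kfun H x₀) 1) = 1 := by
    refine mul_left_cancel₀ hf ?_
    rw [← hmul f _ f fun z ↦ ?_, mul_one]
    rw [orbit_apply, hx₀.mulOp_kfun_apply, OneMemClass.coe_one, Pi.one_apply, mul_one]
  refine ⟨AlgHom.ofLinearMap (τ.toLinearMap ∘ₗ orbit (kfun H x₀)) hone fun φ ψ ↦
    hmul _ _ _ fun z ↦ ?_, hx₀.extends_iff.2 fun _ ↦ rfl⟩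
  simp_rw [orbit_apply, hx₀.mulOp_kfun_apply]
  rfl

end IsNormalizedAt

namespace IsMcCulloughQuiggin

theorem extends_evalChar_iff (h : IsMcCulloughQuiggin X H) (hx₀ : IsNormalizedAt H x₀)
    {τ : StrongDual ℂ H} {x : X} : Extends τ (evalChar H x) ↔ ∀ f : H, τ f = f x := by
  refine ⟨fun hτ f ↦ ?_, fun hτ ↦ hx₀.extends_iff.2 fun φ ↦
    (hτ _).trans (hx₀.mulOp_kfun_apply φ x)⟩
  refine (h.denseRange_orbit_kfun x₀).induction (P := fun f : H ↦ τ f = f x) ?_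
    (isClosed_eq τ.continuous (RKHS.continuous_eval x)) f
  rintro _ ⟨φ, rfl⟩
  exact (hx₀.extends_iff.1 hτ φ).trans (hx₀.mulOp_kfun_apply φ x).symm

theorem exists_extension_tfae (h : IsMcCulloughQuiggin X H) (hx₀ : IsNormalizedAt H x₀)
    (ρ : Character H) :
    List.TFAE [∃ τ : StrongDual ℂ H, IsPartiallyMultiplicative τ ∧ Extends τ ρ,
      IsWeakStarContinuous ρ, ρ ∈ gleasonPart (evalChar H x₀)] := by
  tfae_have 1 → 2 := fun ⟨_, _, hτ⟩ ↦ hx₀.isWeakStarContinuous_of_extends hτ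
  tfae_have 2 → 3 := fun hρ ↦ h.mem_gleasonPart_evalChar hρ x₀
  tfae_have 3 → 1 := h.exists_extension hx₀
  tfae_finish

theorem isMaximalDomain_iff (h : IsMcCulloughQuiggin X H) (hx₀ : IsNormalizedAt H x₀) :
    IsMaximalDomain H ↔
      ∀ ρ : Character H, IsWeakStarContinuous ρ → ∃ x : X, ρ = evalChar H x := by
  refine ⟨fun hmax ρ hρ ↦ ?_, fun heval τ hτ ↦ ?_⟩
  · obtain ⟨τ, hτ, hτρ⟩ := ((h.exists_extension_tfae hx₀ ρ).out 0 1).2 hρ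
    obtain ⟨x, hx⟩ := hmax τ hτ
    have hτx := (h.extends_evalChar_iff hx₀).2 hx
    exact ⟨x, AlgHom.ext fun φ ↦
      (hx₀.extends_iff.1 hτρ φ).symm.trans (hx₀.extends_iff.1 hτx φ)⟩
  · obtain ⟨ρ, hρ⟩ := hx₀.exists_extends hτ
    obtain ⟨x, rfl⟩ := heval ρ (hx₀.isWeakStarContinuous_of_extends hρ)
    exact ⟨x, (h.extends_evalChar_iff hx₀).1 hρ⟩

theorem isGleasonPart_range_evalChar_iff (h : IsMcCulloughQuiggin X H)
    (hx₀ : IsNormalizedAt H x₀) :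
    IsGleasonPart (Set.range (evalChar H)) ↔
      ∀ ρ : Character H, IsWeakStarContinuous ρ → ∃ x : X, ρ = evalChar H x := by
  refine ⟨fun ⟨σ, hσ⟩ ρ hρ ↦ ?_, fun heval ↦ ⟨evalChar H x₀, Set.Subset.antisymm ?_ ?_⟩⟩
  · obtain ⟨x, rfl⟩ := hσ.ge (mem_gleasonPart_self σ)
    obtain ⟨y, hy⟩ := hσ.ge (h.mem_gleasonPart_evalChar hρ x)
    exact ⟨y, hy.symm⟩
  · rintro _ ⟨x, rfl⟩
    exact h.mem_gleasonPart_evalChar (hx₀.isWeakStarContinuous_evalChar x) x₀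
  · intro ρ hρ
    obtain ⟨x, hx⟩ := heval ρ (((h.exists_extension_tfae hx₀ ρ).out 1 2).2 hρ)
    exact ⟨x, hx.symm⟩

end IsMcCulloughQuiggin

end MaximalDomain

end PickSpace

end

theorem proposition1p4 {X : Type*} {H : Type*} [NormedAddCommGroup H] [InnerProductSpace ℂ H]
    [CompleteSpace H] [RKHS ℂ H X ℂ] (hPick : PickSpace.IsCompletePick H)
    (x₀ : X) (hx₀ : PickSpace.IsNormalizedAt H x₀) :
    (∀ ρ : PickSpace.Character H,
      List.TFAE [
        ∃ τ : StrongDual ℂ H, PickSpace.IsPartiallyMultiplicative τ ∧ PickSpace.Extends τ ρ,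
        PickSpace.IsWeakStarContinuous ρ,
        ρ ∈ PickSpace.gleasonPart (PickSpace.evalChar H x₀)]) ∧
    List.TFAE [
      PickSpace.IsMaximalDomain H,
      ∀ ρ : PickSpace.Character H, PickSpace.IsWeakStarContinuous ρ →
        ∃ x : X, ρ = PickSpace.evalChar H x,
      PickSpace.IsGleasonPart (Set.range (PickSpace.evalChar H))] := by
  have h := hPick.isMcCulloughQuiggin hx₀
  refine ⟨h.exists_extension_tfae hx₀, ?_⟩
  tfae_have 1 ↔ 2 := h.isMaximalDomain_iff hx₀
  tfae_have 3 ↔ 2 := h.isGleasonPart_range_evalChar_iff hx₀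
  tfae_finish
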